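/- Let $q,a,b,c,d$ be complex numbers with $0<|q|<1$. For $x\in\mathbb C$ and integers $n\ge 0$ write $$(x;q)_n=\prod_{i=0}^{n-1}(1-xq^i),\qquad (x;q)_\infty=\prod_{i=0}^{\infty}(1-xq^i),\qquad (x_1,\dots,x_r;q)_n=\prod_{j=1}^r (x_j;q)_n \quad (n\in\mathbb Z_{\ge 0}\cup\{\infty\}),$$ let $$\theta(q,x)=\sum_{n=0}^{\infty}(-1)^nq^{\binom n2}x^n$$ be the partial theta function, and for $k\ge 0$ put $$\Theta_k(q,a,b)=\frac{b(1+aq^{k+1})}{a(1+q)}\theta(q,bq^{k+2})-\frac{a(1+bq^{k+1})}{b(1+q)}\theta(q,aq^{k+2})+\frac{1+aq^{k}}{(a+b)q^{k+1}}\theta(q,bq^{k+1})-\frac{1+bq^{k}}{(a+b)q^{k+1}}\theta(q,aq^{k+1}).$$ Suppose that no denominator below vanishes, that is, $a,b,c,d\neq 0$, $a+b\ne 0$, $ab\neq 1$, and for all integers $n\ge 0$: $aq^{n+2}\ne 1$, $bq^{n+2}\neq 1$, $abq^{n+1}\ne c$ and $abq^{n+1}\neq d$. Then both series below converge absolutely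 and $$\sum_{k=0}^{\infty}\frac{1-abq^{2k}}{1-ab}\,\frac{(ab,c,d;q)_k}{(q,abq/c,abq/d;q)_k}\,q^{\binom k2+2k}\Big(-\frac{ab}{cd}\Big)^k\,\Theta_k(q,a,b)$$ $$=\frac{(a-b)(a-bq)(b-aq)}{qab(a+b)(1+q)}\,(q,aq^2,bq^2;q)_\infty\sum_{n=0}^{\infty}\frac{(abq;q)_{2n}\,(abq/cd;q)_n}{(q,aq^2,bq^2,abq/c,abq/d;q)_n}\,q^n .$$ -/

import Mathlib

/-- The finite `q`-shifted factorial `(x; q)_n = (1 - x) (1 - x q) ⋯ (1 - x q ^ (n - 1))`.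
It equals `(x; q)_∞ / (x q ^ n; q)_∞` whenever that quotient makes sense; see
`qShifted_mul_qShiftedInf`. -/
noncomputable def qShifted (x q : ℂ) (n : ℕ) : ℂ :=
  ∏ i ∈ Finset.range n, (1 - x * q ^ i)

/-- The infinite `q`-shifted factorial `(x; q)_∞ = ∏_{i ≥ 0} (1 - x q ^ i)`, for `|q| < 1`. -/
noncomputable def qShiftedInf (x q : ℂ) : ℂ :=
  ∏' i : ℕ, (1 - x * q ^ i)

/-- The partial theta function `θ(q, x) = ∑_{n ≥ 0} (-1) ^ n q ^ (n choose 2) x ^ n`,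
for `|q| < 1`. -/
noncomputable def partialTheta (q x : ℂ) : ℂ :=
  ∑' n : ℕ, (-1) ^ n * q ^ (n.choose 2) * x ^ n

/-- The combination `Θ_k(q, a, b)` of four partial theta functions. -/
noncomputable def thetaCombination (k : ℕ) (q a b : ℂ) : ℂ :=
  b * (1 + a * q ^ (k + 1)) / (a * (1 + q)) * partialTheta q (b * q ^ (k + 2))
    - a * (1 + b * q ^ (k + 1)) / (b * (1 + q)) * partialTheta q (a * q ^ (k + 2))
    + (1 + a * q ^ k) / ((a + b) * q ^ (k + 1)) * partialTheta q (b * q ^ (k + 1))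
    - (1 + b * q ^ k) / ((a + b) * q ^ (k + 1)) * partialTheta q (a * q ^ (k + 1))

/-- The infinite product defining `(x; q)_∞` converges for `|q| < 1`. -/
theorem multipliable_qShiftedInf {q : ℂ} (hq : ‖q‖ < 1) (x : ℂ) :
    Multipliable fun i : ℕ => 1 - x * q ^ i := by
  have h : Summable fun i : ℕ => ‖-(x * q ^ i)‖ := by
    simpa using (summable_geometric_of_lt_one (norm_nonneg q) hq).mul_left ‖x‖
  simpa [sub_eq_add_neg] using multipliable_one_add_of_summable h

/-- `(x; q)_n (x q ^ n; q)_∞ = (x; q)_∞` for `|q| < 1`. -/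
theorem qShifted_mul_qShiftedInf {q : ℂ} (hq : ‖q‖ < 1) (x : ℂ) (n : ℕ) :
    qShifted x q n * qShiftedInf (x * q ^ n) q = qShiftedInf x q := by
  have step : ∀ y : ℂ, qShiftedInf y q = (1 - y) * qShiftedInf (y * q) q := by
    intro y
    have h1 := (multipliable_qShiftedInf hq (y * q)).hasProd
    have h2 : HasProd (fun i : ℕ => 1 - y * q ^ (i + 1)) (qShiftedInf (y * q) q) := by
      have e : (fun i : ℕ => 1 - y * q ^ (i + 1)) = fun i : ℕ => 1 - y * q * q ^ i := by
        funext i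
        ring
      rw [e]
      exact h1
    have h3 := HasProd.zero_mul (f := fun i : ℕ => 1 - y * q ^ i) h2
    simpa [qShiftedInf] using h3.tprod_eq
  induction n with
  | zero => simp [qShifted]
  | succ n ih =>
    rw [← ih, step (x * q ^ n), qShifted, qShifted, Finset.prod_range_succ, pow_succ]
    ring_nf

/-- The series defining `θ(q, x)` converges for `|q| < 1`. -/
theorem summable_partialTheta {q : ℂ} (hq : ‖q‖ < 1) (x : ℂ) :
    Summable fun n : ℕ => (-1) ^ n * q ^ (n.choose 2) * x ^ n := by
  have h0 : Filter.Tendsto (fun n : ℕ => ‖q‖ ^ n * ‖x‖) Filter.atTop (nhds 0) := by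
    simpa using (tendsto_pow_atTop_nhds_zero_of_lt_one (norm_nonneg q) hq).mul_const ‖x‖
  refine summable_of_ratio_norm_eventually_le (r := 1 / 2) (by norm_num) ?_
  filter_upwards [h0.eventually_le_const (show (0 : ℝ) < 1 / 2 by norm_num)] with n hn
  have e : (n + 1).choose 2 = n + n.choose 2 := by
    rw [Nat.choose_succ_succ' n 1, Nat.choose_one_right]
  have : ‖(-1 : ℂ) ^ (n + 1) * q ^ ((n + 1).choose 2) * x ^ (n + 1)‖
      = (‖q‖ ^ n * ‖x‖) * ‖(-1 : ℂ) ^ n * q ^ (n.choose 2) * x ^ n‖ := by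
    simp only [e, norm_mul, norm_pow, norm_neg, norm_one, one_pow, pow_add]
    ring
  rw [this]
  exact mul_le_mul_of_nonneg_right hn (norm_nonneg _)

open Filter Topology

/-! The idea is to expand each `Θ_k` in a series and interchange the order of summation. Put `C =
(a-b)(a-bq)(b-aq) / (qab(a+b)(1+q))` and let `F(a,b)` be the sum over `m` of `q^m (abq^(m+1);q)_m
(q^(m+1), aq^(m+2), bq^(m+2);q)_∞`. Then `Θ_k(q,a,b) = C F(aq^k, bq^k)` (`thetaCombination_eq`). In
the resulting double series, which converges absolutely, the antidiagonal `k + m = n` is, up to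
factors depending on `n` alone, a terminating very well poised `₆φ₅` with base parameter `ab`. Its
closed form (`sum_poisedTerm`) is the `n`-th term on the right-hand side.

The expansion of `Θ_k` rests on Warnaar's theorem: a series `W(x,y)` sums to `θ(q,x) + θ(q,y) - 1`
(`warnaarSum_eq`). Since `θ(q,x) = 1 - x θ(q,xq)`, the combination `x W(xq,y) + W(x,y)` equals
`(1+x) θ(q,y) - x`. Four such combinations give the four partial thetas in `Θ_0`, and termwise they
differ from a multiple of the series `F` by a telescoping difference.

Warnaar's theorem follows from a vanishing mixed `q`-difference of `W` in `x` and `y`, from letting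
`xq^m` and `yq^m` tend to 0, and from Fine's case `y = 0`.

In all the series, quotients of shifted factorials are cancelled and the infinite products
multiplied in. The termwise identities are then nearly polynomial and need no nonvanishing of `1 -
xyq^j` and the like. -/

/-! ### Shifted factorials: recurrences, uniform bounds and limits. -/

theorem qShifted_zero (x q : ℂ) : qShifted x q 0 = 1 := by simp [qShifted]

theorem qShifted_succ (x q : ℂ) (n : ℕ) :
    qShifted x q (n + 1) = qShifted x q n * (1 - x * q ^ n) :=
  Finset.prod_range_succ _ _

theorem qShifted_succ_left (x q : ℂ) (n : ℕ) :
    qShifted x q (n + 1) = (1 - x) * qShifted (x * q) q n := by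
  simp only [qShifted]
  rw [Finset.prod_range_succ', mul_comm]
  congr 1
  · simp
  · exact Finset.prod_congr rfl fun i _ => by ring

theorem qShifted_ne_zero {x q : ℂ} (h : ∀ i : ℕ, x * q ^ i ≠ 1) (n : ℕ) : qShifted x q n ≠ 0 :=
  Finset.prod_ne_zero_iff.mpr fun i _ => sub_ne_zero.mpr (h i).symm

theorem qShiftedInf_step {q : ℂ} (hq : ‖q‖ < 1) (x : ℂ) :
    qShiftedInf x q = (1 - x) * qShiftedInf (x * q) q := by
  rw [← qShifted_mul_qShiftedInf hq x 1]
  simp [qShifted]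

theorem qShiftedInf_mul_pow {q : ℂ} (hq : ‖q‖ < 1) (x : ℂ) (n : ℕ) :
    qShiftedInf (x * q ^ n) q = (1 - x * q ^ n) * qShiftedInf (x * q ^ (n + 1)) q := by
  rw [qShiftedInf_step hq, pow_succ, mul_assoc]

theorem qShiftedInf_pow {q : ℂ} (hq : ‖q‖ < 1) (n : ℕ) :
    qShiftedInf (q ^ n) q = (1 - q ^ n) * qShiftedInf (q ^ (n + 1)) q := by
  rw [qShiftedInf_step hq, pow_succ]

theorem qShiftedInf_zero_left (q : ℂ) : qShiftedInf 0 q = 1 := by simp [qShiftedInf]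

theorem qShifted_zero_left (q : ℂ) (n : ℕ) : qShifted 0 q n = 1 := by simp [qShifted]

theorem summable_norm_mul_pow {q : ℂ} (hq : ‖q‖ < 1) (x : ℂ) :
    Summable fun i : ℕ => ‖-(x * q ^ i)‖ := by
  simpa using (summable_geometric_of_lt_one (norm_nonneg q) hq).mul_left ‖x‖

theorem tsum_norm_mul_pow {q : ℂ} (hq : ‖q‖ < 1) (x : ℂ) :
    ∑' i : ℕ, ‖-(x * q ^ i)‖ = ‖x‖ / (1 - ‖q‖) := by
  simp [tsum_mul_left, tsum_geometric_of_lt_one (norm_nonneg q) hq, div_eq_mul_inv]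

/-- The bound does not depend on `n` and tends to 0 with `x`. It therefore supplies both the
dominating series and the limits in which the length of the product varies together with its
argument. -/
theorem norm_qShifted_sub_one_le {q : ℂ} (hq : ‖q‖ < 1) (x : ℂ) (n : ℕ) :
    ‖qShifted x q n - 1‖ ≤ Real.exp (‖x‖ / (1 - ‖q‖)) - 1 := by
  have h := Finset.norm_prod_one_add_sub_one_le (Finset.range n) (fun i => -(x * q ^ i))
  simp only [← sub_eq_add_neg] at h
  refine h.trans ?_
  gcongr
  rw [← tsum_norm_mul_pow hq x]
  exact (summable_norm_mul_pow hq x).sum_le_tsum _ fun i _ => norm_nonneg _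

theorem tendsto_qShifted {q : ℂ} (x : ℂ) (hq : ‖q‖ < 1) :
    Tendsto (fun n => qShifted x q n) atTop (𝓝 (qShiftedInf x q)) :=
  (multipliable_qShiftedInf hq x).hasProd.tendsto_prod_nat

theorem norm_qShiftedInf_sub_one_le {q : ℂ} (hq : ‖q‖ < 1) (x : ℂ) :
    ‖qShiftedInf x q - 1‖ ≤ Real.exp (‖x‖ / (1 - ‖q‖)) - 1 :=
  le_of_tendsto ((tendsto_qShifted x hq).sub_const 1).norm
    (Eventually.of_forall fun n => norm_qShifted_sub_one_le hq x n)

theorem exp_div_mono {r s t : ℝ} (hr : r < 1) (h : s ≤ t) :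
    Real.exp (s / (1 - r)) ≤ Real.exp (t / (1 - r)) :=
  Real.exp_le_exp.mpr (div_le_div_of_nonneg_right h (sub_nonneg.mpr hr.le))

theorem norm_le_of_norm_sub_one_le {z : ℂ} {t : ℝ} (h : ‖z - 1‖ ≤ t - 1) : ‖z‖ ≤ t := by
  have := norm_add_le (z - 1) 1
  simp only [sub_add_cancel, norm_one] at this
  linarith

theorem norm_qShifted_le {q : ℂ} (hq : ‖q‖ < 1) {x : ℂ} {X : ℝ} (hx : ‖x‖ ≤ X) (n : ℕ) :
    ‖qShifted x q n‖ ≤ Real.exp (X / (1 - ‖q‖)) :=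
  (norm_le_of_norm_sub_one_le (norm_qShifted_sub_one_le hq x n)).trans (exp_div_mono hq hx)

theorem norm_qShiftedInf_le {q : ℂ} (hq : ‖q‖ < 1) {x : ℂ} {X : ℝ} (hx : ‖x‖ ≤ X) :
    ‖qShiftedInf x q‖ ≤ Real.exp (X / (1 - ‖q‖)) :=
  (norm_le_of_norm_sub_one_le (norm_qShiftedInf_sub_one_le hq x)).trans (exp_div_mono hq hx)

theorem tendsto_exp_div_sub_one {q : ℂ} {u : ℕ → ℂ} (hu : Tendsto u atTop (𝓝 0)) :
    Tendsto (fun m => Real.exp (‖u m‖ / (1 - ‖q‖)) - 1) atTop (𝓝 0) := by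
  have h : Tendsto (fun m => ‖u m‖ / (1 - ‖q‖)) atTop (𝓝 0) := by
    simpa using hu.norm.div_const (1 - ‖q‖)
  simpa using ((Real.continuous_exp.tendsto 0).comp h).sub_const 1

theorem tendsto_qShifted_one {q : ℂ} (hq : ‖q‖ < 1) {u : ℕ → ℂ} (hu : Tendsto u atTop (𝓝 0))
    (k : ℕ → ℕ) : Tendsto (fun m => qShifted (u m) q (k m)) atTop (𝓝 1) :=
  tendsto_iff_norm_sub_tendsto_zero.mpr <| squeeze_zero (fun _ => norm_nonneg _)
    (fun m => norm_qShifted_sub_one_le hq (u m) (k m)) (tendsto_exp_div_sub_one hu)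

theorem tendsto_qShiftedInf_one {q : ℂ} (hq : ‖q‖ < 1) {u : ℕ → ℂ} (hu : Tendsto u atTop (𝓝 0)) :
    Tendsto (fun m => qShiftedInf (u m) q) atTop (𝓝 1) :=
  tendsto_iff_norm_sub_tendsto_zero.mpr <| squeeze_zero (fun _ => norm_nonneg _)
    (fun m => norm_qShiftedInf_sub_one_le hq (u m)) (tendsto_exp_div_sub_one hu)

theorem tendsto_mul_pow_add {q : ℂ} (hq : ‖q‖ < 1) (x : ℂ) (k : ℕ) :
    Tendsto (fun n : ℕ => x * q ^ (n + k)) atTop (𝓝 0) := by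
  simpa using ((tendsto_pow_atTop_nhds_zero_of_norm_lt_one hq).comp
    (tendsto_add_atTop_nat k)).const_mul x

theorem tendsto_pow_add {q : ℂ} (hq : ‖q‖ < 1) (k : ℕ) :
    Tendsto (fun n : ℕ => q ^ (n + k)) atTop (𝓝 0) := by
  simpa using tendsto_mul_pow_add hq 1 k

theorem tsum_eq_of_telescoping {f g : ℕ → ℂ} {L : ℂ} (hf : Summable f)
    (hfg : ∀ n, f n = g (n + 1) - g n) (hg : Tendsto g atTop (𝓝 L)) : ∑' n, f n = L - g 0 := by
  refine tendsto_nhds_unique hf.hasSum.tendsto_sum_nat ?_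
  simp only [hfg, Finset.sum_range_sub]
  exact hg.sub_const _

theorem norm_mul_pow_le {q : ℂ} (hq : ‖q‖ < 1) {x : ℂ} {X : ℝ} (hx : ‖x‖ ≤ X) (n : ℕ) :
    ‖x * q ^ n‖ ≤ X := by
  rw [norm_mul, norm_pow]
  exact (mul_le_of_le_one_right (norm_nonneg _) (pow_le_one₀ (norm_nonneg _) hq.le)).trans hx

theorem norm_pow_le_one_of_norm_lt_one {q : ℂ} (hq : ‖q‖ < 1) (n : ℕ) : ‖q ^ n‖ ≤ 1 := by
  rw [norm_pow]
  exact pow_le_one₀ (norm_nonneg _) hq.le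

/-- Passing from index `n` to `n + 1` in the certificates shifts both the argument and the length of
the factorial. This is the one nonpolynomial relation needed to compare the two. -/
theorem one_sub_mul_qShifted (x q : ℂ) (n : ℕ) :
    (1 - x) * qShifted (x * q) q (n + 1) =
      qShifted x q n * (1 - x * q ^ n) * (1 - x * q ^ (n + 1)) := by
  rw [← qShifted_succ_left, qShifted_succ, qShifted_succ]

/-! ### Warnaar's series: convergence and behaviour as an argument tends to 0. -/

/-- The terms of Warnaar's series for `θ(q, x) + θ(q, y) - 1`, namely
`(x y / q; q)_{2n} q ^ n / (q, x, y, x y; q)_n` times `(q, x, y; q)_∞`. -/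
noncomputable def warnaarTerm (q x y : ℂ) : ℕ → ℂ
  | 0 => qShiftedInf q q * qShiftedInf x q * qShiftedInf y q
  | n + 1 => q ^ n * (q - x * y) * qShifted (x * y * q ^ (n + 1)) q n *
      (qShiftedInf (q ^ (n + 2)) q * qShiftedInf (x * q ^ (n + 1)) q *
        qShiftedInf (y * q ^ (n + 1)) q)

/-- The sum of Warnaar's series. -/
noncomputable def warnaarSum (q x y : ℂ) : ℂ := ∑' n, warnaarTerm q x y n

theorem warnaarTerm_symm (q x y : ℂ) (n : ℕ) : warnaarTerm q x y n = warnaarTerm q y x n := by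
  cases n <;> simp only [warnaarTerm, mul_comm y x] <;> ring

theorem warnaarSum_symm (q x y : ℂ) : warnaarSum q x y = warnaarSum q y x :=
  tsum_congr (warnaarTerm_symm q x y)

/-- A bound for the terms of Warnaar's series, uniform for `‖x‖ ≤ X` and `‖y‖ ≤ Y`. -/
theorem norm_warnaarTerm_le {q : ℂ} (hq : ‖q‖ < 1) {x y : ℂ} {X Y : ℝ} (hx : ‖x‖ ≤ X)
    (hy : ‖y‖ ≤ Y) (n : ℕ) :
    ‖warnaarTerm q x y n‖ ≤ ((1 + X * Y) * Real.exp (X * Y / (1 - ‖q‖)) *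
      (Real.exp (1 / (1 - ‖q‖)) * Real.exp (X / (1 - ‖q‖)) * Real.exp (Y / (1 - ‖q‖)))) *
        ‖q‖ ^ (n - 1) := by
  have hX : 0 ≤ X := (norm_nonneg x).trans hx
  have hY : 0 ≤ Y := (norm_nonneg y).trans hy
  have hxy : ‖x * y‖ ≤ X * Y := by rw [norm_mul]; gcongr
  cases n with
  | zero =>
    simp only [warnaarTerm, norm_mul, zero_tsub, pow_zero, mul_one]
    have h1 : 1 ≤ (1 + X * Y) * Real.exp (X * Y / (1 - ‖q‖)) := by
      have h2 : 0 ≤ X * Y := by positivity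
      have h3 : 1 ≤ Real.exp (X * Y / (1 - ‖q‖)) :=
        Real.one_le_exp (div_nonneg h2 (sub_nonneg.mpr hq.le))
      nlinarith
    calc ‖qShiftedInf q q‖ * ‖qShiftedInf x q‖ * ‖qShiftedInf y q‖
        ≤ Real.exp (1 / (1 - ‖q‖)) * Real.exp (X / (1 - ‖q‖)) * Real.exp (Y / (1 - ‖q‖)) := by
          gcongr
          · exact norm_qShiftedInf_le hq hq.le
          · exact norm_qShiftedInf_le hq hx
          · exact norm_qShiftedInf_le hq hy
      _ ≤ _ := le_mul_of_one_le_left (by positivity) h1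
  | succ n =>
    simp only [warnaarTerm, norm_mul, Nat.add_sub_cancel]
    have h0 : ‖q - x * y‖ ≤ 1 + X * Y := (norm_sub_le _ _).trans (add_le_add hq.le hxy)
    rw [norm_pow, mul_comm _ (‖q‖ ^ n), mul_assoc (‖q‖ ^ n), mul_assoc (‖q‖ ^ n)]
    gcongr
    · exact norm_qShifted_le hq (norm_mul_pow_le hq hxy _) n
    · exact norm_qShiftedInf_le hq (norm_pow_le_one_of_norm_lt_one hq _)
    · exact norm_qShiftedInf_le hq (norm_mul_pow_le hq hx _)
    · exact norm_qShiftedInf_le hq (norm_mul_pow_le hq hy _)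

theorem summable_pow_sub_one {r : ℝ} (h0 : 0 ≤ r) (h1 : r < 1) :
    Summable fun n : ℕ => r ^ (n - 1) :=
  (summable_nat_add_iff 1).mp (by simpa using summable_geometric_of_lt_one h0 h1)

theorem summable_warnaarTerm {q : ℂ} (hq : ‖q‖ < 1) (x y : ℂ) : Summable (warnaarTerm q x y) :=
  .of_norm_bounded ((summable_pow_sub_one (norm_nonneg q) hq).mul_left _)
    (norm_warnaarTerm_le hq le_rfl le_rfl)

theorem tendsto_warnaarTerm {q : ℂ} (hq : ‖q‖ < 1) {u : ℕ → ℂ} (hu : Tendsto u atTop (𝓝 0))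
    (y : ℂ) (n : ℕ) :
    Tendsto (fun m => warnaarTerm q (u m) y n) atTop (𝓝 (warnaarTerm q 0 y n)) := by
  cases n with
  | zero =>
    simp only [warnaarTerm, qShiftedInf_zero_left]
    exact ((tendsto_qShiftedInf_one hq hu).const_mul _).mul_const _
  | succ n =>
    simp only [warnaarTerm, zero_mul, qShiftedInf_zero_left, qShifted_zero_left]
    have h1 : Tendsto (fun m => u m * y) atTop (𝓝 0) := by simpa using hu.mul_const y
    have h2 : Tendsto (fun m => u m * y * q ^ (n + 1)) atTop (𝓝 0) := by
      simpa using h1.mul_const (q ^ (n + 1))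
    have h3 : Tendsto (fun m => u m * q ^ (n + 1)) atTop (𝓝 0) := by
      simpa using hu.mul_const (q ^ (n + 1))
    exact (((h1.const_sub q).const_mul _).mul (tendsto_qShifted_one hq h2 fun _ => n)).mul
      (((tendsto_qShiftedInf_one hq h3).const_mul _).mul_const _)

theorem tendsto_warnaarSum {q : ℂ} (hq : ‖q‖ < 1) (x y : ℂ) :
    Tendsto (fun m : ℕ => warnaarSum q (x * q ^ m) y) atTop (𝓝 (warnaarSum q 0 y)) :=
  tendsto_tsum_of_dominated_convergence
    ((summable_pow_sub_one (norm_nonneg q) hq).mul_left _)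
    (tendsto_warnaarTerm hq (tendsto_mul_pow_add hq x 0) y)
    (Eventually.of_forall fun m n => norm_warnaarTerm_le hq (norm_mul_pow_le hq le_rfl m) le_rfl n)

/-! ### The case `y = 0`: Fine's series for the partial theta function. -/

theorem warnaarTerm_zero_right (q x : ℂ) (n : ℕ) :
    warnaarTerm q x 0 n = q ^ n * (qShiftedInf (q ^ (n + 1)) q * qShiftedInf (x * q ^ n) q) := by
  cases n <;> simp only [warnaarTerm, qShiftedInf_zero_left, qShifted_zero_left, mul_zero, zero_mul,
    sub_zero, mul_one, pow_zero, zero_add, pow_one, one_mul]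
  rw [← pow_succ]

/-- The terms of `W(x,0) + x W(xq,0)` are the differences of `(q^n, xq^n; q)_∞`, which is 0 at `n =
0` and tends to 1. -/
theorem warnaarSum_zero_right_step {q : ℂ} (hq : ‖q‖ < 1) (x : ℂ) :
    warnaarSum q x 0 = 1 - x * warnaarSum q (x * q) 0 := by
  have hs := (summable_warnaarTerm hq x 0).add ((summable_warnaarTerm hq (x * q) 0).mul_left x)
  have h := tsum_eq_of_telescoping (L := 1 * 1) hs
    (g := fun n => qShiftedInf (q ^ n) q * qShiftedInf (x * q ^ n) q) (fun n => ?_)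
    ((tendsto_qShiftedInf_one hq (tendsto_pow_add hq 0)).mul
      (tendsto_qShiftedInf_one hq (tendsto_mul_pow_add hq x 0)))
  · rw [(summable_warnaarTerm hq x 0).tsum_add ((summable_warnaarTerm hq (x * q) 0).mul_left x),
      tsum_mul_left] at h
    have h1 : qShiftedInf (q ^ 0) q = 0 := by rw [qShiftedInf_pow hq]; simp
    rw [h1] at h
    simp only [warnaarSum]
    linear_combination h
  · simp only [warnaarTerm_zero_right]
    rw [qShiftedInf_mul_pow hq x n, qShiftedInf_pow hq n,
      show x * q * q ^ n = x * q ^ (n + 1) by ring]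
    ring

/-- Fine's series for the partial theta function. -/
theorem warnaarSum_zero_right {q : ℂ} (hq : ‖q‖ < 1) (x : ℂ) :
    warnaarSum q x 0 = partialTheta q x := by
  -- Iterating the functional equation produces the partial sums of `θ`. The remainder is a term of
  -- the convergent theta series times a factor with a limit.
  have key : ∀ n : ℕ, warnaarSum q x 0 =
      ∑ i ∈ Finset.range n, (-1) ^ i * q ^ (i.choose 2) * x ^ i
        + (-1) ^ n * q ^ (n.choose 2) * x ^ n * warnaarSum q (x * q ^ n) 0 := by
    intro n
    induction n with
    | zero => simp
    | succ n ih =>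
      have e : (n + 1).choose 2 = n + n.choose 2 := by
        rw [Nat.choose_succ_succ' n 1, Nat.choose_one_right]
      rw [ih, Finset.sum_range_succ, warnaarSum_zero_right_step hq (x * q ^ n), e, pow_add q,
        show x * q ^ n * q = x * q ^ (n + 1) by ring]
      ring
  have hs := summable_partialTheta hq x
  have h := hs.hasSum.tendsto_sum_nat.add (hs.tendsto_atTop_zero.mul (tendsto_warnaarSum hq x 0))
  rw [zero_mul, add_zero] at h
  exact tendsto_nhds_unique (tendsto_const_nhds.congr key) h

/-! ### Warnaar's theorem for two partial theta functions. -/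

/-- The certificate for `warnaarSum_mixed_difference`. -/
noncomputable def warnaarCert (q x y : ℂ) : ℕ → ℂ
  | 0 => 0
  | 1 => x * y * (qShiftedInf q q * qShiftedInf (x * q) q * qShiftedInf (y * q) q)
  | n + 2 => x * y * q ^ (n + 1) * ((1 - q) + (1 - x * y) * q ^ (n + 2)) *
      qShifted (x * y * q ^ (n + 3)) q n *
      (qShiftedInf (q ^ (n + 2)) q * qShiftedInf (x * q ^ (n + 2)) q *
        qShiftedInf (y * q ^ (n + 2)) q)

theorem tendsto_warnaarCert {q : ℂ} (hq : ‖q‖ < 1) (x y : ℂ) :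
    Tendsto (warnaarCert q x y) atTop (𝓝 0) := by
  rw [← tendsto_add_atTop_iff_nat 2]
  simp only [warnaarCert]
  have h := ((((tendsto_mul_pow_add hq (x * y) 1).mul
    ((tendsto_mul_pow_add hq (1 - x * y) 2).const_add (1 - q))).mul
    (tendsto_qShifted_one hq (tendsto_mul_pow_add hq (x * y) 3) id)).mul
    (((tendsto_qShiftedInf_one hq (tendsto_pow_add hq 2)).mul
      (tendsto_qShiftedInf_one hq (tendsto_mul_pow_add hq x 2))).mul
      (tendsto_qShiftedInf_one hq (tendsto_mul_pow_add hq y 2))))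
  simpa using h

theorem warnaarTerm_mixed_difference {q : ℂ} (hq : ‖q‖ < 1) (x y : ℂ) (n : ℕ) :
    warnaarTerm q x y n - warnaarTerm q (x * q) y n - warnaarTerm q x (y * q) n
      + warnaarTerm q (x * q) (y * q) n = warnaarCert q x y (n + 1) - warnaarCert q x y n := by
  -- For `N ≥ 2` the certificate contains `(xyq^(N+1); q)_(N-2)`; smaller indices would need
  -- negative lengths and are checked by hand.
  match n with
  | 0 =>
    simp only [warnaarTerm, warnaarCert]
    rw [qShiftedInf_step hq x, qShiftedInf_step hq y]
    ring
  | 1 =>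
    simp only [warnaarTerm, warnaarCert, zero_add, qShifted_zero, pow_one]
    have hq1 := qShiftedInf_pow hq 1
    have hx := qShiftedInf_mul_pow hq x 1
    have hy := qShiftedInf_mul_pow hq y 1
    norm_num at hq1 hx hy
    rw [hq1, hx, hy, show x * q * q = x * q ^ 2 by ring, show y * q * q = y * q ^ 2 by ring]
    ring
  | n + 2 =>
    simp only [warnaarTerm, warnaarCert]
    have hrel := one_sub_mul_qShifted (x * y * q ^ (n + 3)) q n
    have e1 := qShifted_succ_left (x * y * q ^ (n + 2)) q n
    have e2 := qShifted_succ (x * y * q ^ (n + 3)) q n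
    simp only [show n + 1 + 1 = n + 2 from rfl, show n + 1 + 2 = n + 3 from rfl,
      show n + 1 + 3 = n + 4 from rfl]
    rw [show x * q * y * q ^ (n + 2) = x * y * q ^ (n + 3) by ring,
      show x * (y * q) * q ^ (n + 2) = x * y * q ^ (n + 3) by ring,
      show x * q * (y * q) * q ^ (n + 2) = x * y * q ^ (n + 4) by ring,
      show x * q * q ^ (n + 2) = x * q ^ (n + 3) by ring,
      show y * q * q ^ (n + 2) = y * q ^ (n + 3) by ring,
      qShiftedInf_mul_pow hq x (n + 2), qShiftedInf_mul_pow hq y (n + 2),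
      qShiftedInf_pow hq (n + 2), e1, e2]
    rw [show x * y * q ^ (n + 2) * q = x * y * q ^ (n + 3) by ring]
    rw [show x * y * q ^ (n + 3) * q = x * y * q ^ (n + 4) by ring] at hrel
    simp only [show n + 2 + 1 = n + 3 from rfl]
    generalize qShiftedInf (q ^ (n + 3)) q = J at *
    generalize qShiftedInf (x * q ^ (n + 3)) q = Jx at *
    generalize qShiftedInf (y * q ^ (n + 3)) q = Jy at *
    generalize qShifted (x * y * q ^ (n + 4)) q (n + 1) = P2 at *
    generalize qShifted (x * y * q ^ (n + 3)) q n = P1 at *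
    -- Both sides are linear in `P1` and `P2`; the multiplier of `hrel` is chosen to eliminate `P2`.
    linear_combination (q ^ (n + 2) * (1 - x * y) * (J * Jx * Jy)) * hrel

/-- A function of the form `f(x) + g(y)` has zero mixed difference. Here the certificate vanishes at
0 and at infinity, so the telescoping sum is 0. -/
theorem warnaarSum_mixed_difference {q : ℂ} (hq : ‖q‖ < 1) (x y : ℂ) :
    warnaarSum q x y - warnaarSum q (x * q) y =
      warnaarSum q x (y * q) - warnaarSum q (x * q) (y * q) := by
  have h1 := (summable_warnaarTerm hq x y).hasSum
  have h2 := (summable_warnaarTerm hq (x * q) y).hasSum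
  have h3 := (summable_warnaarTerm hq x (y * q)).hasSum
  have h4 := (summable_warnaarTerm hq (x * q) (y * q)).hasSum
  have h := ((h1.sub h2).sub h3).add h4
  have h5 := tsum_eq_of_telescoping h.summable (warnaarTerm_mixed_difference hq x y)
    (tendsto_warnaarCert hq x y)
  rw [h.tsum_eq] at h5
  simp only [warnaarCert, sub_zero] at h5
  simp only [warnaarSum]
  linear_combination h5

/-- Invariance under `x ↦ xq` makes `f` constant along `xq^m`, so only the limit along this sequence
matters. -/
theorem eq_of_eq_mul_of_tendsto {q : ℂ} {f : ℂ → ℂ} {L : ℂ} (h : ∀ x, f x = f (x * q)) (x : ℂ)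
    (hL : Tendsto (fun m : ℕ => f (x * q ^ m)) atTop (𝓝 L)) : f x = L := by
  have key : ∀ m : ℕ, f (x * q ^ m) = f x := by
    intro m
    induction m with
    | zero => simp
    | succ m ih => rw [← ih, h (x * q ^ m), pow_succ, mul_assoc]
  simp only [key] at hL
  exact tendsto_nhds_unique tendsto_const_nhds hL

theorem warnaarSum_sub_mul {q : ℂ} (hq : ‖q‖ < 1) (x y : ℂ) :
    warnaarSum q x y - warnaarSum q (x * q) y = partialTheta q x - partialTheta q (x * q) := by
  rw [← warnaarSum_zero_right hq, ← warnaarSum_zero_right hq]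
  refine eq_of_eq_mul_of_tendsto (q := q) (f := fun y => warnaarSum q x y - warnaarSum q (x * q) y)
    (fun y => warnaarSum_mixed_difference hq x y) y ?_
  simp only [warnaarSum_symm q x, warnaarSum_symm q (x * q)]
  exact (tendsto_warnaarSum hq y x).sub (tendsto_warnaarSum hq y (x * q))

/-- Warnaar's sum of two partial theta functions. -/
theorem warnaarSum_eq {q : ℂ} (hq : ‖q‖ < 1) (x y : ℂ) :
    warnaarSum q x y = partialTheta q x + partialTheta q y - 1 := by
  have h := eq_of_eq_mul_of_tendsto (q := q) (f := fun x => warnaarSum q x y - warnaarSum q x 0)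
    (L := warnaarSum q 0 y - warnaarSum q 0 0)
    (fun x => by
      have := warnaarSum_sub_mul hq x y
      simp only [warnaarSum_zero_right hq]
      linear_combination this) x
    ((tendsto_warnaarSum hq x y).sub (tendsto_warnaarSum hq x 0))
  have h0 : partialTheta q 0 = 1 := by
    rw [partialTheta, tsum_eq_single 0 fun n hn => by simp [hn]]
    simp
  simp only [warnaarSum_zero_right hq, warnaarSum_symm q 0 y, h0] at h
  linear_combination h

/-! ### Series expansion of the theta combination. -/

/-- The terms of the series `∑ q ^ n (a b q ^ (n + 1); q)_n / (q, a q ^ 2, b q ^ 2; q)_n` times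
`(q, a q ^ 2, b q ^ 2; q)_∞`. -/
noncomputable def thetaTerm (q a b : ℂ) (n : ℕ) : ℂ :=
  q ^ n * qShifted (a * b * q ^ (n + 1)) q n *
    (qShiftedInf (q ^ (n + 1)) q * qShiftedInf (a * q ^ (n + 2)) q *
      qShiftedInf (b * q ^ (n + 2)) q)

/-- A geometric bound for `thetaTerm`, uniform for `‖a‖ ≤ X` and `‖b‖ ≤ Y`. -/
theorem norm_thetaTerm_le {q : ℂ} (hq : ‖q‖ < 1) {a b : ℂ} {X Y : ℝ} (ha : ‖a‖ ≤ X) (hb : ‖b‖ ≤ Y)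
    (n : ℕ) :
    ‖thetaTerm q a b n‖ ≤ (Real.exp (X * Y / (1 - ‖q‖)) *
      (Real.exp (1 / (1 - ‖q‖)) * Real.exp (X / (1 - ‖q‖)) * Real.exp (Y / (1 - ‖q‖)))) *
        ‖q‖ ^ n := by
  have hX : 0 ≤ X := (norm_nonneg a).trans ha
  have hab : ‖a * b‖ ≤ X * Y := by rw [norm_mul]; gcongr
  rw [thetaTerm, norm_mul, norm_mul, norm_mul, norm_mul, norm_pow, mul_comm _ (‖q‖ ^ n),
    mul_assoc (‖q‖ ^ n)]
  gcongr
  · exact norm_qShifted_le hq (norm_mul_pow_le hq hab _) n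
  · exact norm_qShiftedInf_le hq (norm_pow_le_one_of_norm_lt_one hq _)
  · exact norm_qShiftedInf_le hq (norm_mul_pow_le hq ha _)
  · exact norm_qShiftedInf_le hq (norm_mul_pow_le hq hb _)

theorem summable_thetaTerm {q : ℂ} (hq : ‖q‖ < 1) (a b : ℂ) : Summable (thetaTerm q a b) :=
  .of_norm_bounded ((summable_geometric_of_lt_one (norm_nonneg q) hq).mul_left _)
    (norm_thetaTerm_le hq le_rfl le_rfl)

/-- The polynomial in the certificate for `tsum_thetaTerm`. -/
def thetaCertPoly (q e s z : ℂ) : ℂ :=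
  (1 + q - q ^ 2 * s) + ((1 + q) + q * s - e * q * (1 + q) ^ 2) * z
    + e * (-(q * (1 + q) ^ 2) + q ^ 2 * s + q ^ 3 * (1 + q) * e) * z ^ 2
    + e * q * ((1 + q) * e * q ^ 2 - s) * z ^ 3

/-- The certificate for `tsum_thetaTerm`. -/
noncomputable def thetaCert (q a b : ℂ) : ℕ → ℂ
  | 0 => 0
  | 1 => a * b * (a - b) * (1 + q) ^ 2 *
      (qShiftedInf q q * qShiftedInf (a * q ^ 2) q * qShiftedInf (b * q ^ 2) q)
  | 2 => a * b * (a - b) * ((1 + q) * (1 + q ^ 2) - q ^ 2 * (a + b) * (1 - q)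
      - a * b * q ^ 3 * (1 + q) * (1 + q ^ 2)) *
      (qShiftedInf (q ^ 2) q * qShiftedInf (a * q ^ 3) q * qShiftedInf (b * q ^ 3) q)
  | m + 3 => a * b * (a - b) * thetaCertPoly q (a * b) (a + b) (q ^ (m + 3)) *
      qShifted (a * b * q ^ (m + 6)) q m *
      (qShiftedInf (q ^ (m + 3)) q * qShiftedInf (a * q ^ (m + 4)) q *
        qShiftedInf (b * q ^ (m + 4)) q)

theorem tendsto_thetaCert {q : ℂ} (hq : ‖q‖ < 1) (a b : ℂ) :
    Tendsto (thetaCert q a b) atTop (𝓝 (a * b * (a - b) * (1 + q - q ^ 2 * (a + b)))) := by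
  rw [← tendsto_add_atTop_iff_nat 3]
  simp only [thetaCert]
  have hc : Continuous (thetaCertPoly q (a * b) (a + b)) := by
    unfold thetaCertPoly
    fun_prop
  have h := ((((hc.tendsto 0).comp (tendsto_pow_add hq 3)).const_mul (a * b * (a - b))).mul
    (tendsto_qShifted_one hq (tendsto_mul_pow_add hq (a * b) 6) id)).mul
    (((tendsto_qShiftedInf_one hq (tendsto_pow_add hq 3)).mul
      (tendsto_qShiftedInf_one hq (tendsto_mul_pow_add hq a 4))).mul
      (tendsto_qShiftedInf_one hq (tendsto_mul_pow_add hq b 4)))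
  simpa [thetaCertPoly] using h

theorem warnaarTerm_succ_of_eq {q x y e X Y : ℂ} {n : ℕ} (he : x * y * q ^ (n + 1) = e)
    (hX : x * q ^ (n + 1) = X) (hY : y * q ^ (n + 1) = Y) :
    warnaarTerm q x y (n + 1) = q ^ n * (q - x * y) * qShifted e q n *
      (qShiftedInf (q ^ (n + 2)) q * qShiftedInf X q * qShiftedInf Y q) := by
  subst he hX hY
  rfl

/-- The subtracted part consists of four blocks `x W(xq,y) + W(x,y)`, with `(x,y)` equal to `(aq,
bq^2)`, `(bq, aq^2)`, `(a, bq)`, `(b, aq)` up to the symmetry of `W`. Each block sums to `(1+x)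
θ(q,y) - x`. -/
theorem thetaTerm_telescoping {q : ℂ} (hq : ‖q‖ < 1) (a b : ℂ) (n : ℕ) :
    (a - b) * (a - b * q) * (b - a * q) * thetaTerm q a b n
      - ((q * b ^ 2 * (a + b)) * (a * q * warnaarTerm q (a * q ^ 2) (b * q ^ 2) n
          + warnaarTerm q (a * q) (b * q ^ 2) n)
        - (q * a ^ 2 * (a + b)) * (b * q * warnaarTerm q (a * q ^ 2) (b * q ^ 2) n
          + warnaarTerm q (a * q ^ 2) (b * q) n)
        + (a * b * (1 + q)) * (a * warnaarTerm q (a * q) (b * q) n + warnaarTerm q a (b * q) n)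
        - (a * b * (1 + q)) * (b * warnaarTerm q (a * q) (b * q) n + warnaarTerm q (a * q) b n))
      = thetaCert q a b (n + 1) - thetaCert q a b n := by
  have hJ := qShiftedInf_pow hq
  have hI := qShiftedInf_mul_pow hq
  -- The generic certificate contains `(abq^(N+3); q)_(N-3)`, so it is available only for `N ≥ 3`.
  match n with
  | 0 =>
    simp only [warnaarTerm, thetaTerm, thetaCert, qShifted_zero]
    have ha := qShiftedInf_step hq a
    have hb := qShiftedInf_step hq b
    have ha1 := hI a 1
    have hb1 := hI b 1
    norm_num at ha1 hb1 ⊢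
    rw [ha, hb, ha1, hb1]
    ring
  | 1 =>
    rw [warnaarTerm_succ_of_eq (e := a * b * q ^ 5) (X := a * q ^ 3) (Y := b * q ^ 3)
        (by ring) (by ring) (by ring),
      warnaarTerm_succ_of_eq (e := a * b * q ^ 4) (X := a * q ^ 2) (Y := b * q ^ 3)
        (by ring) (by ring) (by ring),
      warnaarTerm_succ_of_eq (e := a * b * q ^ 4) (X := a * q ^ 3) (Y := b * q ^ 2)
        (by ring) (by ring) (by ring),
      warnaarTerm_succ_of_eq (e := a * b * q ^ 3) (X := a * q ^ 2) (Y := b * q ^ 2)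
        (by ring) (by ring) (by ring),
      warnaarTerm_succ_of_eq (e := a * b * q ^ 2) (X := a * q ^ 1) (Y := b * q ^ 2)
        (by ring) (by ring) (by ring),
      warnaarTerm_succ_of_eq (e := a * b * q ^ 2) (X := a * q ^ 2) (Y := b * q ^ 1)
        (by ring) (by ring) (by ring)]
    have hq1 := hJ 1
    rw [pow_one] at hq1
    simp only [thetaTerm, thetaCert, hI _ 1, hI _ 2, hq1, Nat.reduceAdd, zero_add, qShifted_zero,
      show qShifted (a * b * q ^ 2) q 1 = 1 - a * b * q ^ 2 by simp [qShifted]]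
    ring
  | 2 =>
    rw [warnaarTerm_succ_of_eq (e := a * b * q ^ 6) (X := a * q ^ 4) (Y := b * q ^ 4)
        (by ring) (by ring) (by ring),
      warnaarTerm_succ_of_eq (e := a * b * q ^ 5) (X := a * q ^ 3) (Y := b * q ^ 4)
        (by ring) (by ring) (by ring),
      warnaarTerm_succ_of_eq (e := a * b * q ^ 5) (X := a * q ^ 4) (Y := b * q ^ 3)
        (by ring) (by ring) (by ring),
      warnaarTerm_succ_of_eq (e := a * b * q ^ 4) (X := a * q ^ 3) (Y := b * q ^ 3)
        (by ring) (by ring) (by ring),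
      warnaarTerm_succ_of_eq (e := a * b * q ^ 3) (X := a * q ^ 2) (Y := b * q ^ 3)
        (by ring) (by ring) (by ring),
      warnaarTerm_succ_of_eq (e := a * b * q ^ 3) (X := a * q ^ 3) (Y := b * q ^ 2)
        (by ring) (by ring) (by ring)]
    have h1 : ∀ x, qShifted x q 1 = 1 - x := fun x => by simp [qShifted]
    have h2 : qShifted (a * b * q ^ 3) q 2 = (1 - a * b * q ^ 3) * (1 - a * b * q ^ 4) := by
      rw [qShifted_succ, h1]
      ring
    simp only [thetaTerm, thetaCert, thetaCertPoly, hI _ 2, hI _ 3, hJ 2, Nat.reduceAdd, zero_add,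
      qShifted_zero, h1, h2]
    ring
  | m + 3 =>
    rw [warnaarTerm_succ_of_eq (e := a * b * q ^ (m + 7)) (X := a * q ^ (m + 5))
        (Y := b * q ^ (m + 5)) (by ring) (by ring) (by ring),
      warnaarTerm_succ_of_eq (e := a * b * q ^ (m + 6)) (X := a * q ^ (m + 4))
        (Y := b * q ^ (m + 5)) (by ring) (by ring) (by ring),
      warnaarTerm_succ_of_eq (e := a * b * q ^ (m + 6)) (X := a * q ^ (m + 5))
        (Y := b * q ^ (m + 4)) (by ring) (by ring) (by ring),
      warnaarTerm_succ_of_eq (e := a * b * q ^ (m + 5)) (X := a * q ^ (m + 4))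
        (Y := b * q ^ (m + 4)) (by ring) (by ring) (by ring),
      warnaarTerm_succ_of_eq (e := a * b * q ^ (m + 4)) (X := a * q ^ (m + 3))
        (Y := b * q ^ (m + 4)) (by ring) (by ring) (by ring),
      warnaarTerm_succ_of_eq (e := a * b * q ^ (m + 4)) (X := a * q ^ (m + 4))
        (Y := b * q ^ (m + 3)) (by ring) (by ring) (by ring)]
    have hrel := one_sub_mul_qShifted (a * b * q ^ (m + 6)) q m
    rw [show a * b * q ^ (m + 6) * q = a * b * q ^ (m + 7) by ring] at hrel
    have e1 : qShifted (a * b * q ^ (m + 5)) q (m + 2) =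
        (1 - a * b * q ^ (m + 5)) * (qShifted (a * b * q ^ (m + 6)) q m *
          (1 - a * b * q ^ (m + 6) * q ^ m)) := by
      rw [qShifted_succ_left, qShifted_succ,
        show a * b * q ^ (m + 5) * q = a * b * q ^ (m + 6) by ring]
    have e2 : qShifted (a * b * q ^ (m + 4)) q (m + 2) =
        (1 - a * b * q ^ (m + 4)) * ((1 - a * b * q ^ (m + 5)) *
          qShifted (a * b * q ^ (m + 6)) q m) := by
      rw [qShifted_succ_left, qShifted_succ_left,
        show a * b * q ^ (m + 4) * q = a * b * q ^ (m + 5) by ring,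
        show a * b * q ^ (m + 5) * q = a * b * q ^ (m + 6) by ring]
    have e3 : qShifted (a * b * q ^ (m + 4)) q (m + 3) =
        (1 - a * b * q ^ (m + 4)) * ((1 - a * b * q ^ (m + 5)) *
          (qShifted (a * b * q ^ (m + 6)) q m * (1 - a * b * q ^ (m + 6) * q ^ m))) := by
      rw [qShifted_succ_left, show a * b * q ^ (m + 4) * q = a * b * q ^ (m + 5) by ring, e1]
    simp only [thetaTerm, thetaCert, show m + 2 + 2 = m + 4 from rfl,
      show m + 3 + 2 = m + 5 from rfl, show m + 1 + 6 = m + 7 from rfl]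
    rw [e1, e2, e3, qShifted_succ (a * b * q ^ (m + 7)) q (m + 1),
      qShifted_succ (a * b * q ^ (m + 6)) q (m + 1), qShifted_succ (a * b * q ^ (m + 6)) q m]
    simp only [hI _ (m + 3), hI _ (m + 4), hJ (m + 3), show m + 3 + 1 = m + 4 from rfl,
      show m + 4 + 1 = m + 5 from rfl]
    clear e1 e2 e3 hI hJ
    generalize qShiftedInf (q ^ (m + 4)) q = J at *
    generalize qShiftedInf (a * q ^ (m + 5)) q = Ja at *
    generalize qShiftedInf (b * q ^ (m + 5)) q = Jb at *
    generalize qShifted (a * b * q ^ (m + 7)) q (m + 1) = P2 at *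
    generalize qShifted (a * b * q ^ (m + 6)) q m = P1 at *
    simp only [pow_add] at *
    generalize q ^ m = z at *
    simp only [thetaCertPoly]
    -- Every term is now a polynomial in `z = q^m` times `P1` or `P2`; the multiplier of `hrel`
    -- eliminates `P2`.
    linear_combination (-(a * b * (a - b)) * (1 + q - q ^ 2 * (a + b)
      + q * (1 + q) * (1 - a * b * q) * (z * q ^ 3)
      + a * b * (q ^ 4 * (a + b) - q ^ 3 * (1 + q)) * (z * q ^ 3) ^ 2) * (J * Ja * Jb)) * hrel

theorem partialTheta_eq {q : ℂ} (hq : ‖q‖ < 1) (x : ℂ) :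
    partialTheta q x = 1 - x * partialTheta q (x * q) := by
  rw [← warnaarSum_zero_right hq, warnaarSum_zero_right_step hq, warnaarSum_zero_right hq]

theorem hasSum_warnaarTerm {q : ℂ} (hq : ‖q‖ < 1) (x y : ℂ) :
    HasSum (warnaarTerm q x y) (partialTheta q x + partialTheta q y - 1) :=
  warnaarSum_eq hq x y ▸ (summable_warnaarTerm hq x y).hasSum

theorem tsum_thetaTerm {q : ℂ} (hq : ‖q‖ < 1) (a b : ℂ) :
    (a - b) * (a - b * q) * (b - a * q) * ∑' n, thetaTerm q a b n =
      q * b ^ 2 * (a + b) * (1 + a * q) * partialTheta q (b * q ^ 2)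
        - q * a ^ 2 * (a + b) * (1 + b * q) * partialTheta q (a * q ^ 2)
        + a * b * (1 + q) * (1 + a) * partialTheta q (b * q)
        - a * b * (1 + q) * (1 + b) * partialTheta q (a * q) := by
  have hF := (summable_thetaTerm hq a b).hasSum
  have h22 := hasSum_warnaarTerm hq (a * q ^ 2) (b * q ^ 2)
  have h12 := hasSum_warnaarTerm hq (a * q) (b * q ^ 2)
  have h21 := hasSum_warnaarTerm hq (a * q ^ 2) (b * q)
  have h11 := hasSum_warnaarTerm hq (a * q) (b * q)
  have h01 := hasSum_warnaarTerm hq a (b * q)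
  have h10 := hasSum_warnaarTerm hq (a * q) b
  have h := (hF.mul_left ((a - b) * (a - b * q) * (b - a * q))).sub
    ((((((h22.mul_left (a * q)).add h12).mul_left (q * b ^ 2 * (a + b))).sub
      (((h22.mul_left (b * q)).add h21).mul_left (q * a ^ 2 * (a + b)))).add
      (((h11.mul_left a).add h01).mul_left (a * b * (1 + q)))).sub
      (((h11.mul_left b).add h10).mul_left (a * b * (1 + q))))
  -- The limit of the certificate is not 0: it cancels the constants `-x` left over by the four
  -- blocks.
  have h' := tsum_eq_of_telescoping h.summable (thetaTerm_telescoping hq a b)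
    (tendsto_thetaCert hq a b)
  rw [h.tsum_eq] at h'
  simp only [thetaCert, sub_zero] at h'
  have ta := partialTheta_eq hq (a * q)
  have tb := partialTheta_eq hq (b * q)
  have ta0 := partialTheta_eq hq a
  have tb0 := partialTheta_eq hq b
  rw [show a * q * q = a * q ^ 2 by ring] at ta
  rw [show b * q * q = b * q ^ 2 by ring] at tb
  rw [ta0, tb0, ta, tb] at h'
  rw [ta, tb]
  linear_combination h'

/-- The case `k = 0` of `thetaCombination_eq`. -/
theorem thetaCombination_zero_eq {q a b : ℂ} (hq0 : q ≠ 0) (hq : ‖q‖ < 1) (ha : a ≠ 0) (hb : b ≠ 0)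
    (hab : a + b ≠ 0) :
    thetaCombination 0 q a b = (a - b) * (a - b * q) * (b - a * q) / (q * a * b * (a + b) * (1 + q)) *
      ∑' n, thetaTerm q a b n := by
  have hq2 : 1 + q ≠ 0 := fun h => by
    rw [eq_neg_of_add_eq_zero_right h, norm_neg, norm_one] at hq
    exact lt_irrefl _ hq
  rw [div_mul_eq_mul_div, tsum_thetaTerm hq]
  simp only [thetaCombination, zero_add, pow_zero, mul_one, pow_one]
  field_simp

/-- `Θ_k(q,a,b) = Θ_0(q, aq^k, bq^k)`, and the prefactor is homogeneous of degree 0 in `(a,b)`. -/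
theorem thetaCombination_eq {q a b : ℂ} (hq0 : q ≠ 0) (hq : ‖q‖ < 1) (ha : a ≠ 0) (hb : b ≠ 0)
    (hab : a + b ≠ 0) (k : ℕ) :
    thetaCombination k q a b = (a - b) * (a - b * q) * (b - a * q) / (q * a * b * (a + b) * (1 + q)) *
      ∑' n, thetaTerm q (a * q ^ k) (b * q ^ k) n := by
  have hk : q ^ k ≠ 0 := pow_ne_zero _ hq0
  have h1 : thetaCombination k q a b = thetaCombination 0 q (a * q ^ k) (b * q ^ k) := by
    simp only [thetaCombination, zero_add, pow_zero, mul_one, pow_one]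
    rw [show a * q ^ k * q ^ 2 = a * q ^ (k + 2) by ring,
      show b * q ^ k * q ^ 2 = b * q ^ (k + 2) by ring,
      show a * q ^ k * q = a * q ^ (k + 1) by ring, show b * q ^ k * q = b * q ^ (k + 1) by ring,
      show (a * q ^ k + b * q ^ k) * q = (a + b) * q ^ (k + 1) by ring,
      mul_right_comm b (q ^ k) (1 + a * q ^ (k + 1)), mul_right_comm a (q ^ k) (1 + q),
      mul_right_comm a (q ^ k) (1 + b * q ^ (k + 1)), mul_right_comm b (q ^ k) (1 + q),
      mul_div_mul_right _ _ hk, mul_div_mul_right _ _ hk]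
  have h2 : (a * q ^ k - b * q ^ k) * (a * q ^ k - b * q ^ k * q) * (b * q ^ k - a * q ^ k * q) /
      (q * (a * q ^ k) * (b * q ^ k) * (a * q ^ k + b * q ^ k) * (1 + q)) =
      (a - b) * (a - b * q) * (b - a * q) / (q * a * b * (a + b) * (1 + q)) := by
    rw [← mul_div_mul_right _ (q * a * b * (a + b) * (1 + q)) (pow_ne_zero 3 hk)]
    congr 1 <;> ring
  rw [h1, thetaCombination_zero_eq hq0 hq (mul_ne_zero ha hk) (mul_ne_zero hb hk), h2]
  rw [← add_mul]
  exact mul_ne_zero hab hk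

/-! ### The terminating very well poised `₆φ₅` sum. -/

/-- The coefficient `(A, c, d; q)_k / (q, A q / c, A q / d; q)_k q ^ (k choose 2) (-A q / c d) ^ k`
of the very well poised series. -/
noncomputable def poisedCoeff (q A c d : ℂ) (k : ℕ) : ℂ :=
  (qShifted A q k * qShifted c q k * qShifted d q k) /
    (qShifted q q k * qShifted (A * q / c) q k * qShifted (A * q / d) q k) *
    q ^ (k.choose 2) * (-(A * q / (c * d))) ^ k

theorem div_mul_ratio_cancel {t u v T U V : ℂ} (h1 : t ≠ 0) (h2 : u ≠ 0) (h3 : v ≠ 0) (h4 : T ≠ 0)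
    (h5 : U ≠ 0) (h6 : V ≠ 0) (a b f a' b' f' p p' w z : ℂ) :
    a * a' * (b * b') * (f * f') / (T * t * (U * u) * (V * v)) * (p * p') * (w * z) * (t * u * v) =
      a * b * f / (T * U * V) * p' * w * (a' * b' * f' * p * z) := by
  field_simp

theorem poisedCoeff_succ {q A c d : ℂ} (hq : ∀ n : ℕ, q * q ^ n ≠ 1)
    (hc : ∀ n : ℕ, A * q / c * q ^ n ≠ 1) (hd : ∀ n : ℕ, A * q / d * q ^ n ≠ 1) (k : ℕ) :
    poisedCoeff q A c d (k + 1) *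
        ((1 - q * q ^ k) * (1 - A * q / c * q ^ k) * (1 - A * q / d * q ^ k)) =
      poisedCoeff q A c d k * ((1 - A * q ^ k) * (1 - c * q ^ k) * (1 - d * q ^ k) * q ^ k *
        -(A * q / (c * d))) := by
  have e : (k + 1).choose 2 = k + k.choose 2 := by
    rw [Nat.choose_succ_succ' k 1, Nat.choose_one_right]
  have h1 := sub_ne_zero.mpr (hq k).symm
  have h2 := sub_ne_zero.mpr (hc k).symm
  have h3 := sub_ne_zero.mpr (hd k).symm
  have h4 := qShifted_ne_zero hq k
  have h5 := qShifted_ne_zero hc k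
  have h6 := qShifted_ne_zero hd k
  rw [poisedCoeff, poisedCoeff, qShifted_succ, qShifted_succ, qShifted_succ, qShifted_succ,
    qShifted_succ, qShifted_succ, e, pow_add q, pow_succ (-(A * q / (c * d)))]
  exact div_mul_ratio_cancel h1 h2 h3 h4 h5 h6 _ _ _ _ _ _ _ _ _ _

/-- The terms of the terminating very well poised series `₆φ₅`, multiplied by
`(1 - A) (A q ^ (n + 1); q)_n`. -/
noncomputable def poisedTerm (q A c d : ℂ) (n k : ℕ) : ℂ :=
  (1 - A * q ^ (2 * k)) * poisedCoeff q A c d k * (qShifted q q n / qShifted q q (n - k)) *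
    qShifted (A * q ^ (n + k + 1)) q (n - k)

/-- The certificate for `sum_poisedTerm`. -/
noncomputable def poisedCert (q A c d : ℂ) (n k : ℕ) : ℂ :=
  -(poisedCoeff q A c d k * ((1 - q ^ k) * (1 - A * q ^ k / c) * (1 - A * q ^ k / d)) *
    (1 - A * q ^ (2 * n + 2)) * q ^ (n + 1 - k) * (qShifted q q n / qShifted q q (n + 1 - k)) *
    qShifted (A * q ^ (n + k + 1)) q (n + 1 - k))

/-- The two factors on the left encode the ratio of consecutive values of the closed form, as in the
method of Wilf and Zeilberger. Writing `n = k + m` avoids truncated subtraction. -/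
theorem poisedTerm_telescoping {q A c d : ℂ} (hc0 : c ≠ 0) (hd0 : d ≠ 0)
    (hq : ∀ n : ℕ, q * q ^ n ≠ 1)
    (hc : ∀ n : ℕ, A * q / c * q ^ n ≠ 1) (hd : ∀ n : ℕ, A * q / d * q ^ n ≠ 1) (k m : ℕ) :
    (1 - A * q / c * q ^ (k + m)) * (1 - A * q / d * q ^ (k + m)) *
        poisedTerm q A c d (k + m + 1) k
      - (1 - A * q ^ (2 * (k + m) + 1)) * (1 - A * q ^ (2 * (k + m) + 2)) *
        (1 - A * q / (c * d) * q ^ (k + m)) * poisedTerm q A c d (k + m) k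
      = poisedCert q A c d (k + m) (k + 1) - poisedCert q A c d (k + m) k := by
  have hv := poisedCoeff_succ hq hc hd k
  have hrel := (qShifted_succ_left (A * q ^ (k + m + k + 1)) q m).symm.trans
    (qShifted_succ (A * q ^ (k + m + k + 1)) q m)
  have e1 := qShifted_succ_left (A * q ^ (k + m + k + 1)) q m
  have e2 := qShifted_succ (A * q ^ (k + m + k + 2)) q m
  have hx : A * q ^ (k + m + k + 1) * q = A * q ^ (k + m + k + 2) := by ring
  rw [hx] at e1 hrel
  have hQ0 := qShifted_ne_zero hq m
  have hQ1 := sub_ne_zero.mpr (hq m).symm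
  have hQ : qShifted q q (k + m) / qShifted q q m =
      qShifted q q (k + m) / qShifted q q (m + 1) * (1 - q * q ^ m) := by
    rw [qShifted_succ q q m]
    field_simp
  have hQ' : qShifted q q (k + m + 1) / qShifted q q (m + 1) =
      qShifted q q (k + m) / qShifted q q (m + 1) * (1 - q * q ^ (k + m)) := by
    rw [qShifted_succ q q (k + m)]
    ring
  simp only [poisedTerm, poisedCert, show k + m + 1 - k = m + 1 by omega,
    show k + m - k = m by omega, show k + m + 1 - (k + 1) = m by omega,
    show k + m + 1 + k + 1 = k + m + k + 2 by ring, show k + m + (k + 1) + 1 = k + m + k + 2 by ring]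
  rw [hQ, hQ', e1, e2]
  clear hQ hQ' e1 e2 hx hQ0 hQ1
  generalize qShifted q q (k + m) / qShifted q q (m + 1) = Q at *
  generalize qShifted (A * q ^ (k + m + k + 2)) q m = P1 at *
  generalize qShifted (A * q ^ (k + m + k + 1)) q m = P0 at *
  generalize poisedCoeff q A c d (k + 1) = v1 at *
  generalize poisedCoeff q A c d k = v at *
  simp only [two_mul, pow_add, pow_one] at *
  generalize q ^ k = x at *
  generalize q ^ m = y at *
  -- This is the rational identity in `x = q^k`, `y = q^m` that remains once the ratio of
  -- consecutive coefficients (`hv`) and the shift of the factorial (`hrel`) are accounted for.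
  have core : (1 - A * q / c * (x * y)) * (1 - A * q / d * (x * y)) * (1 - A * (x * x)) *
        (1 - q * (x * y))
      - (1 - A * q / (c * d) * (x * y)) * (1 - q * y) * (1 - A * (x * x)) *
        (1 - A * (x * y * x * q))
      = (1 - A * x) * (1 - c * x) * (1 - d * x) * x * (A * q / (c * d)) * y * (1 - q * y)
      + (1 - x) * (1 - A * x / c) * (1 - A * x / d) * (y * q) * (1 - A * (x * y * x * q)) := by
    field_simp
    ring
  linear_combination (v * Q * P1 * (1 - A * (x * y * (x * y) * q ^ 2))) * core
    + (((1 - A * (x * y * (x * y) * q ^ 2)) * y * Q * (1 - q * y) * P1)) * hv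
    + ((1 - A * (x * y * (x * y) * q ^ 2)) * (1 - A * q / (c * d) * (x * y)) * (1 - A * (x * x)) * v
        * Q * (1 - q * y)) * hrel

/-- The terminating `₆φ₅` summation. -/
theorem sum_poisedTerm {q A c d : ℂ} (hc0 : c ≠ 0) (hd0 : d ≠ 0) (hq : ∀ n : ℕ, q * q ^ n ≠ 1)
    (hc : ∀ n : ℕ, A * q / c * q ^ n ≠ 1) (hd : ∀ n : ℕ, A * q / d * q ^ n ≠ 1) (n : ℕ) :
    ∑ k ∈ Finset.range (n + 1), poisedTerm q A c d n k =
      (1 - A) * (qShifted (A * q) q (2 * n) * qShifted (A * q / (c * d)) q n /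
        (qShifted (A * q / c) q n * qShifted (A * q / d) q n)) := by
  induction n with
  | zero => simp [poisedTerm, poisedCoeff, qShifted_zero]
  | succ n ih =>
    have h2 := sub_ne_zero.mpr (hc n).symm
    have h3 := sub_ne_zero.mpr (hd n).symm
    have h5 := qShifted_ne_zero hc n
    have h6 := qShifted_ne_zero hd n
    have tele : (1 - A * q / c * q ^ n) * (1 - A * q / d * q ^ n) *
          ∑ k ∈ Finset.range (n + 1), poisedTerm q A c d (n + 1) k
        - (1 - A * q ^ (2 * n + 1)) * (1 - A * q ^ (2 * n + 2)) * (1 - A * q / (c * d) * q ^ n) *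
          ∑ k ∈ Finset.range (n + 1), poisedTerm q A c d n k
        = poisedCert q A c d n (n + 1) := by
      have h0 : poisedCert q A c d n 0 = 0 := by simp [poisedCert]
      rw [Finset.mul_sum, Finset.mul_sum, ← Finset.sum_sub_distrib, ← sub_zero (poisedCert _ _ _ _ _ _),
        ← h0, ← Finset.sum_range_sub]
      refine Finset.sum_congr rfl fun k hk => ?_
      obtain ⟨m, rfl⟩ := Nat.exists_eq_add_of_le (Nat.lt_succ_iff.mp (Finset.mem_range.mp hk))
      exact poisedTerm_telescoping hc0 hd0 hq hc hd k m
    -- The new top term `k = n + 1` is kept out of the telescoping, because truncated `n - k` would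
    -- not make the old term vanish there. It cancels the boundary value of the certificate.
    have last : (1 - A * q / c * q ^ n) * (1 - A * q / d * q ^ n) *
        poisedTerm q A c d (n + 1) (n + 1) = -poisedCert q A c d n (n + 1) := by
      simp only [poisedTerm, poisedCert, Nat.sub_self, qShifted_zero, qShifted_succ q q n]
      ring
    rw [ih] at tele
    have key : (1 - A * q / c * q ^ n) * (1 - A * q / d * q ^ n) *
        ∑ k ∈ Finset.range (n + 1 + 1), poisedTerm q A c d (n + 1) k =
        (1 - A * q ^ (2 * n + 1)) * (1 - A * q ^ (2 * n + 2)) * (1 - A * q / (c * d) * q ^ n) *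
          ((1 - A) * (qShifted (A * q) q (2 * n) * qShifted (A * q / (c * d)) q n /
            (qShifted (A * q / c) q n * qShifted (A * q / d) q n))) := by
      rw [Finset.sum_range_succ]
      linear_combination tele + last
    refine mul_left_cancel₀ (mul_ne_zero h2 h3) (key.trans ?_)
    rw [show 2 * (n + 1) = 2 * n + 1 + 1 by ring]
    simp only [qShifted_succ]
    rw [show A * q * q ^ (2 * n) = A * q ^ (2 * n + 1) by ring,
      show A * q * q ^ (2 * n + 1) = A * q ^ (2 * n + 2) by ring]
    clear key last tele ih
    generalize 1 - A * q / c * q ^ n = u at *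
    generalize 1 - A * q / d * q ^ n = v at *
    field_simp

/-! ### Absolute convergence and interchange of summation. -/

theorem qShiftedInf_ne_zero {q : ℂ} (hq : ‖q‖ < 1) {x : ℂ} (h : ∀ i : ℕ, x * q ^ i ≠ 1) :
    qShiftedInf x q ≠ 0 := by
  have := tprod_one_add_ne_zero_of_summable (f := fun i : ℕ => -(x * q ^ i))
    (fun i => by rw [← sub_eq_add_neg]; exact sub_ne_zero.mpr (h i).symm)
    (summable_norm_mul_pow hq x)
  simpa [qShiftedInf, sub_eq_add_neg] using this

theorem mul_pow_self_ne_one {q : ℂ} (hq : ‖q‖ < 1) (n : ℕ) : q * q ^ n ≠ 1 := fun h => by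
  have h1 := congrArg norm h
  rw [← pow_succ', norm_pow, norm_one] at h1
  exact (pow_lt_one₀ (norm_nonneg q) hq n.succ_ne_zero).ne h1

/-- The ratio of consecutive coefficients tends to 0 because of the factor `q^k` coming from `q ^
(k.choose 2)`. -/
theorem summable_poisedCoeff {q A c d : ℂ} (hq : ‖q‖ < 1)
    (hc : ∀ n : ℕ, A * q / c * q ^ n ≠ 1) (hd : ∀ n : ℕ, A * q / d * q ^ n ≠ 1) :
    Summable (poisedCoeff q A c d) := by
  have t : ∀ x : ℂ, Tendsto (fun k : ℕ => 1 - x * q ^ k) atTop (𝓝 1) := fun x => by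
    simpa using (tendsto_mul_pow_add hq x 0).const_sub 1
  have h := ((((t A).mul (t c)).mul (t d)).mul (tendsto_pow_add hq 0)).mul_const
    (-(A * q / (c * d)))
  have h' := (h.div (((t q).mul (t (A * q / c))).mul (t (A * q / d))) (by norm_num)).norm
  rw [mul_zero, zero_mul, zero_div, norm_zero] at h'
  refine summable_of_ratio_norm_eventually_le (r := 1 / 2) (by norm_num) ?_
  filter_upwards [h'.eventually_le_const (show (0 : ℝ) < 1 / 2 by norm_num)] with k hk
  have hne : (1 - q * q ^ k) * (1 - A * q / c * q ^ k) * (1 - A * q / d * q ^ k) ≠ 0 :=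
    mul_ne_zero (mul_ne_zero (sub_ne_zero.mpr (mul_pow_self_ne_one hq k).symm)
      (sub_ne_zero.mpr (hc k).symm)) (sub_ne_zero.mpr (hd k).symm)
  rw [eq_div_of_mul_eq hne (poisedCoeff_succ (mul_pow_self_ne_one hq) hc hd k), mul_div_assoc,
    norm_mul, mul_comm]
  exact mul_le_mul_of_nonneg_right hk (norm_nonneg _)

/-- Summation over `ℕ × ℕ` by rows and by antidiagonals. -/
theorem hasSum_rows_and_antidiagonals {f : ℕ × ℕ → ℂ} (hf : Summable f) :
    HasSum (fun k => ∑' m, f (k, m)) (∑' p, f p) ∧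
      HasSum (fun n => ∑ k ∈ Finset.range (n + 1), f (k, n - k)) (∑' p, f p) := by
  refine ⟨hf.hasSum.prod_fiberwise fun k => (hf.prod_factor k).hasSum, ?_⟩
  have h := (Finset.HasAntidiagonal.sigmaAntidiagonalEquivProd (A := ℕ)).hasSum_iff.mpr hf.hasSum
  refine HasSum.sigma h fun n => ?_
  rw [← Finset.Nat.sum_antidiagonal_eq_sum_range_succ_mk, ← Finset.sum_coe_sort]
  exact hasSum_fintype _

/-- The double series obtained by expanding each `Θ_k`. -/
noncomputable def doubleTerm (q a b c d : ℂ) (p : ℕ × ℕ) : ℂ :=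
  (1 - a * b * q ^ (2 * p.1)) / (1 - a * b) * poisedCoeff q (a * b) c d p.1 * q ^ p.1 *
    thetaTerm q (a * q ^ p.1) (b * q ^ p.1) p.2

/-- Since `‖aq^k‖ ≤ ‖a‖` and `‖bq^k‖ ≤ ‖b‖`, the geometric bound in `m` is uniform in `k`, and the
double series is dominated by a product of two convergent series. -/
theorem summable_doubleTerm {q a b c d : ℂ} (hq : ‖q‖ < 1)
    (hc : ∀ n : ℕ, a * b * q / c * q ^ n ≠ 1) (hd : ∀ n : ℕ, a * b * q / d * q ^ n ≠ 1) :
    Summable (doubleTerm q a b c d) := by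
  have h1 := ((summable_poisedCoeff hq hc hd).norm.mul_left
    ((1 + ‖a * b‖) / ‖1 - a * b‖)).mul_of_nonneg
    ((summable_geometric_of_lt_one (norm_nonneg q) hq).mul_left (Real.exp (‖a‖ * ‖b‖ / (1 - ‖q‖)) *
      (Real.exp (1 / (1 - ‖q‖)) * Real.exp (‖a‖ / (1 - ‖q‖)) * Real.exp (‖b‖ / (1 - ‖q‖)))))
    (fun _ => by positivity) (fun _ => by positivity)
  refine .of_norm_bounded h1 fun p => ?_
  rw [doubleTerm, norm_mul, norm_mul, norm_mul, norm_div]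
  refine mul_le_mul ?_ (norm_thetaTerm_le hq (norm_mul_pow_le hq le_rfl _)
    (norm_mul_pow_le hq le_rfl _) _) (norm_nonneg _) (by positivity)
  refine (mul_le_of_le_one_right (by positivity) (norm_pow_le_one_of_norm_lt_one hq _)).trans ?_
  gcongr
  refine (norm_sub_le _ _).trans ?_
  rw [norm_one]
  gcongr
  exact norm_mul_pow_le hq le_rfl _

/-- With `n = k + m`, the products containing `a` and `b` separately depend on `n` only, and
`(q^(m+1);q)_∞` gives the ratio `(q;q)_n / (q;q)_(n-k)` of the `₆φ₅`. -/
theorem doubleTerm_antidiagonal {q a b c d : ℂ} (hq : ‖q‖ < 1) (k m : ℕ) :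
    doubleTerm q a b c d (k, m) = poisedTerm q (a * b) c d (k + m) k * (q ^ (k + m) / (1 - a * b) *
      (qShiftedInf (q ^ (k + m + 1)) q * qShiftedInf (a * q ^ (k + m + 2)) q *
        qShiftedInf (b * q ^ (k + m + 2)) q)) := by
  have h0 := qShifted_ne_zero (mul_pow_self_ne_one hq) m
  have h1 := qShifted_mul_qShiftedInf hq q m
  have h2 := qShifted_mul_qShiftedInf hq q (k + m)
  rw [← pow_succ'] at h1 h2
  have h3 : qShiftedInf (q ^ (m + 1)) q =
      qShifted q q (k + m) / qShifted q q m * qShiftedInf (q ^ (k + m + 1)) q := by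
    rw [div_mul_eq_mul_div, h2, ← h1, mul_div_cancel_left₀ _ h0]
  simp only [doubleTerm, poisedTerm, thetaTerm, show k + m - k = m by omega]
  rw [h3, show a * q ^ k * (b * q ^ k) * q ^ (m + 1) = a * b * q ^ (k + m + k + 1) by ring,
    show a * q ^ k * q ^ (m + 2) = a * q ^ (k + m + 2) by ring,
    show b * q ^ k * q ^ (m + 2) = b * q ^ (k + m + 2) by ring]
  ring

theorem sum_doubleTerm {q a b c d : ℂ} (hq : ‖q‖ < 1) (hc0 : c ≠ 0) (hd0 : d ≠ 0)
    (hab1 : a * b ≠ 1) (haq : ∀ n : ℕ, a * q ^ 2 * q ^ n ≠ 1)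
    (hbq : ∀ n : ℕ, b * q ^ 2 * q ^ n ≠ 1)
    (hc : ∀ n : ℕ, a * b * q / c * q ^ n ≠ 1) (hd : ∀ n : ℕ, a * b * q / d * q ^ n ≠ 1) (n : ℕ) :
    ∑ k ∈ Finset.range (n + 1), doubleTerm q a b c d (k, n - k) =
      (qShiftedInf q q * qShiftedInf (a * q ^ 2) q * qShiftedInf (b * q ^ 2) q) *
        ((qShifted (a * b * q) q (2 * n) * qShifted (a * b * q / (c * d)) q n)
          / (qShifted q q n * qShifted (a * q ^ 2) q n * qShifted (b * q ^ 2) q n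
            * qShifted (a * b * q / c) q n * qShifted (a * b * q / d) q n) * q ^ n) := by
  have h : ∀ k ∈ Finset.range (n + 1), doubleTerm q a b c d (k, n - k) =
      poisedTerm q (a * b) c d n k * (q ^ n / (1 - a * b) *
        (qShiftedInf (q ^ (n + 1)) q * qShiftedInf (a * q ^ (n + 2)) q *
          qShiftedInf (b * q ^ (n + 2)) q)) := by
    intro k hk
    obtain ⟨m, rfl⟩ := Nat.exists_eq_add_of_le (Nat.lt_succ_iff.mp (Finset.mem_range.mp hk))
    rw [Nat.add_sub_cancel_left]
    exact doubleTerm_antidiagonal hq k m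
  rw [Finset.sum_congr rfl h, ← Finset.sum_mul,
    sum_poisedTerm hc0 hd0 (mul_pow_self_ne_one hq) hc hd, ← qShifted_mul_qShiftedInf hq q n,
    ← qShifted_mul_qShiftedInf hq (a * q ^ 2) n, ← qShifted_mul_qShiftedInf hq (b * q ^ 2) n,
    show q * q ^ n = q ^ (n + 1) by ring, show a * q ^ 2 * q ^ n = a * q ^ (n + 2) by ring,
    show b * q ^ 2 * q ^ n = b * q ^ (n + 2) by ring]
  have h1 := sub_ne_zero.mpr hab1.symm
  have h2 := qShifted_ne_zero (mul_pow_self_ne_one hq) n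
  have h3 := qShifted_ne_zero haq n
  have h4 := qShifted_ne_zero hbq n
  generalize qShifted (a * b * q / c) q n = u
  generalize qShifted (a * b * q / d) q n = v
  generalize qShifted (a * b * q / (c * d)) q n = w
  field_simp

theorem mainTheorem5 (q a b c d : ℂ) (hq0 : q ≠ 0) (hq1 : ‖q‖ < 1)
    (ha : a ≠ 0) (hb : b ≠ 0) (hc : c ≠ 0) (hd : d ≠ 0)
    (hab : a + b ≠ 0) (hab1 : a * b ≠ 1)
    (haq : ∀ n : ℕ, a * q ^ (n + 2) ≠ 1) (hbq : ∀ n : ℕ, b * q ^ (n + 2) ≠ 1)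
    (habc : ∀ n : ℕ, a * b * q ^ (n + 1) ≠ c) (habd : ∀ n : ℕ, a * b * q ^ (n + 1) ≠ d) :
    Summable (fun k : ℕ =>
      (1 - a * b * q ^ (2 * k)) / (1 - a * b)
        * ((qShifted (a * b) q k * qShifted c q k * qShifted d q k)
          / (qShifted q q k * qShifted (a * b * q / c) q k * qShifted (a * b * q / d) q k))
        * q ^ (k.choose 2 + 2 * k) * (-(a * b / (c * d))) ^ k * thetaCombination k q a b) ∧
    Summable (fun n : ℕ =>
      (qShifted (a * b * q) q (2 * n) * qShifted (a * b * q / (c * d)) q n)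
        / (qShifted q q n * qShifted (a * q ^ 2) q n * qShifted (b * q ^ 2) q n
          * qShifted (a * b * q / c) q n * qShifted (a * b * q / d) q n) * q ^ n) ∧
    ∑' k : ℕ,
      (1 - a * b * q ^ (2 * k)) / (1 - a * b)
        * ((qShifted (a * b) q k * qShifted c q k * qShifted d q k)
          / (qShifted q q k * qShifted (a * b * q / c) q k * qShifted (a * b * q / d) q k))
        * q ^ (k.choose 2 + 2 * k) * (-(a * b / (c * d))) ^ k * thetaCombination k q a b
    = (a - b) * (a - b * q) * (b - a * q) / (q * a * b * (a + b) * (1 + q))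
        * (qShiftedInf q q * qShiftedInf (a * q ^ 2) q * qShiftedInf (b * q ^ 2) q)
        * ∑' n : ℕ,
          (qShifted (a * b * q) q (2 * n) * qShifted (a * b * q / (c * d)) q n)
            / (qShifted q q n * qShifted (a * q ^ 2) q n * qShifted (b * q ^ 2) q n
              * qShifted (a * b * q / c) q n * qShifted (a * b * q / d) q n) * q ^ n := by
  have haq' : ∀ n : ℕ, a * q ^ 2 * q ^ n ≠ 1 := fun n h => haq n (by rw [← h]; ring)
  have hbq' : ∀ n : ℕ, b * q ^ 2 * q ^ n ≠ 1 := fun n h => hbq n (by rw [← h]; ring)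
  have hc' : ∀ n : ℕ, a * b * q / c * q ^ n ≠ 1 := fun n h => habc n (by
    rw [div_mul_eq_mul_div, div_eq_one_iff_eq hc] at h
    rw [← h]; ring)
  have hd' : ∀ n : ℕ, a * b * q / d * q ^ n ≠ 1 := fun n h => habd n (by
    rw [div_mul_eq_mul_div, div_eq_one_iff_eq hd] at h
    rw [← h]; ring)
  obtain ⟨hrow, hdiag⟩ := hasSum_rows_and_antidiagonals
    (summable_doubleTerm (a := a) (b := b) hq1 hc' hd')
  simp only [sum_doubleTerm hq1 hc hd hab1 haq' hbq' hc' hd'] at hdiag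
  -- The diagonal sums carry this product as a factor; it must be nonzero for the summability of the
  -- right-hand series to follow.
  have hP : qShiftedInf q q * qShiftedInf (a * q ^ 2) q * qShiftedInf (b * q ^ 2) q ≠ 0 :=
    mul_ne_zero (mul_ne_zero (qShiftedInf_ne_zero hq1 (mul_pow_self_ne_one hq1))
      (qShiftedInf_ne_zero hq1 haq')) (qShiftedInf_ne_zero hq1 hbq')
  have hL := hrow.mul_left ((a - b) * (a - b * q) * (b - a * q) / (q * a * b * (a + b) * (1 + q)))
  have hterm : ∀ k : ℕ, (1 - a * b * q ^ (2 * k)) / (1 - a * b)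
        * ((qShifted (a * b) q k * qShifted c q k * qShifted d q k)
          / (qShifted q q k * qShifted (a * b * q / c) q k * qShifted (a * b * q / d) q k))
        * q ^ (k.choose 2 + 2 * k) * (-(a * b / (c * d))) ^ k * thetaCombination k q a b =
      (a - b) * (a - b * q) * (b - a * q) / (q * a * b * (a + b) * (1 + q)) *
        ∑' m, doubleTerm q a b c d (k, m) := by
    intro k
    simp only [doubleTerm, tsum_mul_left, thetaCombination_eq hq0 hq1 ha hb hab, poisedCoeff]
    -- Of `q^(2k)`, one factor `q^k` belongs to the `₆φ₅` coefficient; the other joins `q^m` to form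
    -- `q^n` on the antidiagonal.
    rw [show -(a * b * q / (c * d)) = -(a * b / (c * d)) * q by ring, mul_pow, two_mul k,
      pow_add q (k.choose 2), pow_add q k]
    ring
  simp only [hterm]
  refine ⟨hL.summable, (summable_mul_left_iff hP).mp hdiag.summable, ?_⟩
  rw [hL.tsum_eq, ← hdiag.tsum_eq, tsum_mul_left, ← mul_assoc]
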